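/- Let $m,n\ge 1$ be integers, let $A\in\mathbb{R}^{m\times n}$, $\lambda\in\mathbb{R}$ and $\varepsilon\in(0,1)$. For $k\ge1$ let $\mathcal{S}^{k-1}$ be the Euclidean unit sphere of $\mathbb{R}^k$, and define $$\Phi_{m,n}(\lambda A)=\mathbb{E}_{u,v}\, e^{\lambda u^\top A v},$$ where $u$ and $v$ are independent random vectors distributed uniformly on $\mathcal{S}^{m-1}$ and $\mathcal{S}^{n-1}$, respectively. Then $$\Phi_{m,n}(\lambda A)\ \ge\ (1-\varepsilon^2)^{\frac{m+n}{2}}\, e^{\varepsilon^2\|\lambda A\|},$$ where $\|\cdot\|$ is the operator norm with respect to the Euclidean norms on $\mathbb{R}^n$ and $\mathbb{R}^m$. -/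

import Mathlib

open MeasureTheory
open scoped Matrix

noncomputable section

/-- The uniform probability distribution on the unit sphere `S^{n-1}` of `ℝⁿ` (for `n ≥ 1`):
the surface measure induced by Lebesgue measure, divided by its total mass. -/
def uniformSphere (n : ℕ) : Measure (Metric.sphere (0 : EuclideanSpace ℝ (Fin n)) 1) :=
  ((volume : Measure (EuclideanSpace ℝ (Fin n))).toSphere Set.univ)⁻¹ •
    (volume : Measure (EuclideanSpace ℝ (Fin n))).toSphere

/-- For `n ≥ 1` the normalisation is not degenerate. -/
theorem uniformSphere_isProbabilityMeasure {n : ℕ} (hn : 1 ≤ n) :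
    IsProbabilityMeasure (uniformSphere n) := by
  have : Nonempty (Fin n) := ⟨⟨0, hn⟩⟩
  refine ⟨?_⟩
  rw [uniformSphere, Measure.smul_apply, smul_eq_mul]
  refine ENNReal.inv_mul_cancel ?_ (measure_ne_top _ _)
  rw [Ne, Measure.measure_univ_eq_zero]
  exact Measure.toSphere_ne_zero _

/-- The matrix energy function `Φ_{m,n}(B) = E exp(uᵀ B v)`, where `u` and `v` are independent and
uniformly distributed on `S^{m-1}` and `S^{n-1}` respectively. -/
def matrixEnergy {m n : ℕ} (B : Matrix (Fin m) (Fin n) ℝ) : ℝ :=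
  ∫ p, Real.exp (p.1.1.ofLp ⬝ᵥ (B *ᵥ p.2.1.ofLp)) ∂((uniformSphere m).prod (uniformSphere n))

/-- The operator norm of a real matrix with respect to the Euclidean norms. -/
def matrixOpNorm {m n : ℕ} (B : Matrix (Fin m) (Fin n) ℝ) : ℝ :=
  ‖LinearMap.toContinuousLinearMap (Matrix.toEuclideanLin B)‖

end

/-! The Laplace transform of the uniform law on the sphere of `ℝⁿ` at `w` is `₀F₁(; n/2; ‖w‖²/4)`,
by computing moments. A scalar inequality bounds it below by `(1-ε²)^(n/2) exp(ε‖w‖)`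
(`rpow_mul_exp_le_besselSeries`), and this bound is used twice. With `T` the operator of the matrix
and `v₀` a unit vector, averaging over `v` gives `exp(ε‖T*u‖) ≥ exp⟨εTv₀, u⟩` up to the constant;
averaging this over `u` gives `exp(ε²‖Tv₀‖)`. Then `v₀` varies over the unit sphere.

The scalar inequality is proved at the `ε` optimal for the given `r = ‖w‖`, by monotonicity along
the curve of optimal pairs. The derivative has the right sign by `sq_besselSeries_le`, the
nonnegativity of a variance. -/

/-! ### The series `₀F₁` -/

/-- The `k`-th coefficient of the confluent hypergeometric limit function `₀F₁(; a; ·)`. -/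
noncomputable def besselCoeff (a : ℝ) (k : ℕ) : ℝ := ((k.factorial : ℝ) * ∏ i ∈ Finset.range k, (a + i))⁻¹

/-- The confluent hypergeometric limit function `₀F₁(; a; z)`. -/
noncomputable def besselSeries (a z : ℝ) : ℝ := ∑' k, besselCoeff a k * z ^ k

theorem besselCoeff_zero (a : ℝ) : besselCoeff a 0 = 1 := by simp [besselCoeff]

theorem besselCoeff_pos {a : ℝ} (ha : 0 < a) (k : ℕ) : 0 < besselCoeff a k := by
  have : 0 < ∏ i ∈ Finset.range k, (a + i) := Finset.prod_pos fun i _ => by positivity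
  unfold besselCoeff; positivity

theorem besselCoeff_succ {a : ℝ} (ha : 0 < a) (k : ℕ) :
    ((k : ℝ) + 1) * (a + k) * besselCoeff a (k + 1) = besselCoeff a k := by
  have : 0 < ∏ i ∈ Finset.range k, (a + i) := Finset.prod_pos fun i _ => by positivity
  have h : 0 < a + k := by positivity
  unfold besselCoeff
  rw [Finset.prod_range_succ, Nat.factorial_succ]
  push_cast
  field_simp

theorem besselCoeff_succ_shift {a : ℝ} (ha : 0 < a) (k : ℕ) :
    a * (((k : ℝ) + 1) * besselCoeff a (k + 1)) = besselCoeff (a + 1) k := by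
  have : 0 < ∏ i ∈ Finset.range k, (a + 1 + i) := Finset.prod_pos fun i _ => by positivity
  unfold besselCoeff
  rw [Finset.prod_range_succ', Nat.factorial_succ]
  have h : ∀ i : ℕ, a + ((i + 1 : ℕ) : ℝ) = a + 1 + i := fun i => by push_cast; ring
  simp only [h]
  push_cast
  rw [add_zero]
  field_simp

theorem besselCoeff_shift {a : ℝ} (ha : 0 < a) (k : ℕ) :
    a * besselCoeff a k = (a + k) * besselCoeff (a + 1) k := by
  rw [← besselCoeff_succ_shift ha, ← besselCoeff_succ ha]
  ring

theorem besselCoeff_le {a : ℝ} (ha : 0 < a) (k : ℕ) :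
    besselCoeff a k ≤ (a⁻¹) ^ k / k.factorial := by
  have : a ^ k ≤ ∏ i ∈ Finset.range k, (a + i) := by
    calc a ^ k = ∏ i ∈ Finset.range k, a := by simp
      _ ≤ _ := Finset.prod_le_prod (fun _ _ => ha.le) fun i _ => by
        have : (0 : ℝ) ≤ i := by positivity
        linarith
  unfold besselCoeff
  rw [inv_pow, div_eq_mul_inv, ← mul_inv, mul_comm]
  gcongr

theorem summable_besselSeries {a : ℝ} (ha : 0 < a) (z : ℝ) :
    Summable fun k => besselCoeff a k * z ^ k := by
  refine Summable.of_norm_bounded (Real.summable_pow_div_factorial (a⁻¹ * |z|)) fun k => ?_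
  rw [norm_mul, norm_pow, Real.norm_eq_abs, Real.norm_eq_abs, abs_of_pos (besselCoeff_pos ha k),
    mul_pow, mul_div_right_comm]
  gcongr
  exact besselCoeff_le ha k

theorem one_le_besselSeries {a z : ℝ} (ha : 0 < a) (hz : 0 ≤ z) : 1 ≤ besselSeries a z := by
  have h := (summable_besselSeries ha z).le_tsum 0 fun k _ =>
    mul_nonneg (besselCoeff_pos ha k).le (pow_nonneg hz k)
  simpa only [besselCoeff_zero, pow_zero, mul_one, besselSeries] using h

theorem summable_deriv_besselSeries {a : ℝ} (ha : 0 < a) (z : ℝ) :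
    Summable fun k : ℕ => besselCoeff a k * (k * z ^ (k - 1)) := by
  rw [← summable_nat_add_iff 1]
  refine ((summable_besselSeries (a := a + 1) (by positivity) z).mul_left a⁻¹).congr fun k => ?_
  rw [← besselCoeff_succ_shift ha]
  push_cast
  field_simp

theorem tsum_deriv_besselSeries {a : ℝ} (ha : 0 < a) (z : ℝ) :
    ∑' k : ℕ, besselCoeff a k * (k * z ^ (k - 1)) = besselSeries (a + 1) z / a := by
  rw [(summable_deriv_besselSeries ha z).tsum_eq_zero_add, besselSeries, ← tsum_div_const]
  simp only [CharP.cast_eq_zero, zero_mul, mul_zero, zero_add]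
  refine tsum_congr fun k => ?_
  rw [← besselCoeff_succ_shift ha]
  push_cast
  field_simp

theorem hasDerivAt_besselSeries {a : ℝ} (ha : 0 < a) (z : ℝ) :
    HasDerivAt (besselSeries a) (besselSeries (a + 1) z / a) z := by
  rw [← tsum_deriv_besselSeries ha]
  -- On this ball the differentiated terms are dominated by their values at `|z| + 1`.
  have hz : z ∈ Metric.ball (0 : ℝ) (|z| + 1) := by simp
  refine hasDerivAt_tsum_of_isPreconnected (summable_deriv_besselSeries ha (|z| + 1))
    Metric.isOpen_ball (convex_ball _ _).isPreconnected
    (fun k y _ => (hasDerivAt_pow k y).const_mul _) (fun k y hy => ?_)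
    hz (summable_besselSeries ha z) hz
  rw [mem_ball_zero_iff] at hy
  rw [norm_mul, norm_mul, norm_pow, Real.norm_of_nonneg (besselCoeff_pos ha k).le,
    Real.norm_of_nonneg k.cast_nonneg]
  have := (besselCoeff_pos ha k).le
  gcongr

/-! ### The scalar lower bound -/

/-- Log-convexity in `log z` of the power series `₀F₁(; a + 1; z)`, which has positive
coefficients, expressed through `₀F₁(; a; z)`. -/
theorem sq_besselSeries_le {a z : ℝ} (ha : 0 < a) (hz : 0 ≤ z) :
    besselSeries a z ^ 2 ≤
      besselSeries a z * besselSeries (a + 1) z + z * besselSeries (a + 1) z ^ 2 / a ^ 2 := by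
  have hb : 0 < a + 1 := by positivity
  set F := besselSeries a z with hF
  set G := besselSeries (a + 1) z with hG
  set g : ℕ → ℝ := fun k => besselCoeff (a + 1) k * z ^ k with hg
  have hg0 : ∀ k, 0 ≤ g k := fun k => mul_nonneg (besselCoeff_pos hb k).le (pow_nonneg hz k)
  have s0 : HasSum g G := (summable_besselSeries hb z).hasSum
  have s1 : HasSum (fun k => k * g k) (a * (F - G)) := by
    have := (((summable_besselSeries ha z).hasSum.sub s0)).mul_left a
    refine this.congr_fun fun k => ?_
    simp only [hg]
    linear_combination -z ^ k * besselCoeff_shift ha k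
  have s2 : HasSum (fun k : ℕ => (k : ℝ) * (a + k) * g k) (z * G) := by
    rw [← hasSum_nat_add_iff' 1]
    simp only [Finset.range_one, Finset.sum_singleton, CharP.cast_eq_zero, zero_mul, sub_zero]
    refine (s0.mul_left z).congr_fun fun k => ?_
    simp only [hg]
    rw [← besselCoeff_succ hb k]
    push_cast
    ring
  have hG1 : 1 ≤ G := one_le_besselSeries hb hz
  set B := a * (F - G) with hB
  -- Under the weights `g k`, of total mass `G`, the index `k` has mean `B / G`. Summing `g k * (G *
  -- k - B) ^ 2` gives `G ^ 3` times its variance.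
  have s3 := ((s2.sub (s1.mul_left a)).mul_left (G ^ 2)).sub
    ((s1.mul_left (2 * G * B)).sub (s0.mul_left (B ^ 2)))
  have h3 := s3.nonneg fun k => by
    have : 0 ≤ g k * (G * k - B) ^ 2 := mul_nonneg (hg0 k) (sq_nonneg _)
    linear_combination this
  have h4 : 0 ≤ G * (G * (z * G - a * B) - B ^ 2) := by linear_combination h3
  have h5 := nonneg_of_mul_nonneg_right h4 (by linarith)
  have h6 : F * G + z * G ^ 2 / a ^ 2 - F ^ 2 = (G * (z * G - a * B) - B ^ 2) / a ^ 2 := by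
    rw [hB]; field_simp; ring
  have : 0 ≤ F * G + z * G ^ 2 / a ^ 2 - F ^ 2 := by rw [h6]; positivity
  linarith

/-- Here `r = 2aδ/(1-δ²)` is the value for which `δ` maximizes `ε ↦ a log(1-ε²) + εr`, and `z =
r²/4`. The difference of the two sides is nonnegative at `δ = 0` and nondecreasing in `δ`. -/
theorem le_log_besselSeries_of_param {a δ : ℝ} (ha : 0 < a) (h0 : 0 ≤ δ) (h1 : δ < 1) :
    a * Real.log (1 - δ ^ 2) + δ * (2 * a * δ / (1 - δ ^ 2)) ≤
      Real.log (besselSeries a ((a * δ / (1 - δ ^ 2)) ^ 2)) := by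
  set J : ℝ → ℝ := fun x => Real.log (besselSeries a ((a * x / (1 - x ^ 2)) ^ 2)) -
    (a * Real.log (1 - x ^ 2) + x * (2 * a * x / (1 - x ^ 2))) with hJ
  have hd : ∀ x ∈ Set.Ico (0 : ℝ) 1, ∃ J', HasDerivAt J J' x ∧ 0 ≤ J' := by
    intro x ⟨hx0, hx1⟩
    have hq : 0 < 1 - x ^ 2 := by nlinarith
    set z := (a * x / (1 - x ^ 2)) ^ 2 with hz
    have hz0 : 0 ≤ z := sq_nonneg _
    have hF := one_le_besselSeries ha hz0
    have hG := one_le_besselSeries (a := a + 1) (by positivity) hz0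
    have hFG := sq_besselSeries_le ha hz0
    set F := besselSeries a z with hFdef
    set G := besselSeries (a + 1) z with hGdef
    have dq : HasDerivAt (fun x : ℝ => 1 - x ^ 2) (-(2 * x)) x := by
      simpa using (hasDerivAt_pow 2 x).const_sub 1
    have dr : HasDerivAt (fun x : ℝ => a * x / (1 - x ^ 2))
        (a * (1 + x ^ 2) / (1 - x ^ 2) ^ 2) x := by
      refine (((hasDerivAt_id x).const_mul a).div dq hq.ne').congr_deriv ?_
      simp only [id]; field_simp; ring
    have dr2 : HasDerivAt (fun x : ℝ => 2 * a * x / (1 - x ^ 2))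
        (2 * (a * (1 + x ^ 2) / (1 - x ^ 2) ^ 2)) x := by
      refine (dr.const_mul 2).congr_of_eventuallyEq (.of_forall fun y => ?_)
      ring
    have dF := ((hasDerivAt_besselSeries ha z).comp x (dr.pow 2)).log (by
      change F ≠ 0; linarith)
    have dJ := dF.sub (((dq.log hq.ne').const_mul a).add ((hasDerivAt_id x).mul dr2))
    refine ⟨_, dJ, ?_⟩
    have e : (G / a * (2 * (a * x / (1 - x ^ 2)) * (a * (1 + x ^ 2) / (1 - x ^ 2) ^ 2)) / F -
        (a * (-(2 * x) / (1 - x ^ 2)) + (1 * (2 * a * x / (1 - x ^ 2)) +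
          x * (2 * (a * (1 + x ^ 2) / (1 - x ^ 2) ^ 2)))))
        = 2 * (a * (1 + x ^ 2) / (1 - x ^ 2) ^ 2) * x / (F * (1 - x ^ 2)) *
          (G - F * (1 - x ^ 2)) := by
      field_simp; ring
    -- At this `z`, the quadratic inequality `hFG` factors, and the second factor is positive.
    have key : 0 ≤ G - F * (1 - x ^ 2) := by
      have h : F ^ 2 * (1 - x ^ 2) ^ 2 ≤ F * G * (1 - x ^ 2) ^ 2 + x ^ 2 * G ^ 2 := by
        have := mul_le_mul_of_nonneg_right hFG (sq_nonneg (1 - x ^ 2))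
        have e2 : z * G ^ 2 / a ^ 2 * (1 - x ^ 2) ^ 2 = x ^ 2 * G ^ 2 := by
          rw [hz]; field_simp
        linarith
      have h' : 0 ≤ (G - F * (1 - x ^ 2)) * (x ^ 2 * G + F * (1 - x ^ 2)) := by
        linear_combination h
      exact nonneg_of_mul_nonneg_left h' (by positivity)
    refine le_of_le_of_eq (mul_nonneg (show 0 ≤ 2 * (a * (1 + x ^ 2) / (1 - x ^ 2) ^ 2) * x /
      (F * (1 - x ^ 2)) by positivity) key) (e.symm.trans ?_)
    simp [hFdef, hGdef, hz]
  have hmono : MonotoneOn J (Set.Ico 0 1) := by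
    refine monotoneOn_of_deriv_nonneg (convex_Ico 0 1)
      (fun x hx => ((hd x hx).choose_spec.1).continuousAt.continuousWithinAt)
      (fun x hx => ?_) fun x hx => ?_
    all_goals
      rw [interior_Ico] at hx
      obtain ⟨J', h, h'⟩ := hd x ⟨hx.1.le, hx.2⟩
    · exact h.differentiableAt.differentiableWithinAt
    · rwa [h.deriv]
  have h := hmono (show (0 : ℝ) ∈ Set.Ico (0 : ℝ) 1 by simp) ⟨h0, h1⟩ h0
  have hJ0 : 0 ≤ J 0 := by
    simp only [hJ]
    simpa using Real.log_nonneg (one_le_besselSeries ha le_rfl)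
  have := hJ0.trans h
  simp only [hJ] at this
  linarith

theorem rpow_mul_exp_le_besselSeries {a ε r : ℝ} (ha : 0 < a) (hε0 : 0 < ε) (hε1 : ε < 1)
    (hr : 0 ≤ r) : (1 - ε ^ 2) ^ a * Real.exp (ε * r) ≤ besselSeries a (r ^ 2 / 4) := by
  set s := Real.sqrt (a ^ 2 + r ^ 2) with hs
  have hs2 : s ^ 2 = a ^ 2 + r ^ 2 := Real.sq_sqrt (by positivity)
  have hs0 : 0 ≤ s := Real.sqrt_nonneg _
  have has : 0 < a + s := by positivity
  -- The nonnegative root of `rδ² + 2aδ = r`, the critical point equation, in a form valid also at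
  -- `r = 0`.
  set δ := r / (a + s) with hδ
  have hδ0 : 0 ≤ δ := by positivity
  have hq : 1 - δ ^ 2 = 2 * a / (a + s) := by
    rw [hδ]; field_simp; linear_combination hs2
  have hqpos : 0 < 1 - δ ^ 2 := by rw [hq]; positivity
  have hδ1 : δ < 1 := by nlinarith
  have hrδ : 2 * a * δ / (1 - δ ^ 2) = r := by
    rw [hq, hδ]; field_simp
  have hrδ' : (a * δ / (1 - δ ^ 2)) ^ 2 = r ^ 2 / 4 := by
    rw [← hrδ]; field_simp; norm_num
  have h := le_log_besselSeries_of_param ha hδ0 hδ1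
  rw [hrδ', hrδ] at h
  have hF : 0 < besselSeries a (r ^ 2 / 4) :=
    zero_lt_one.trans_le (one_le_besselSeries ha (by positivity))
  have hεq : 0 < 1 - ε ^ 2 := by nlinarith
  rw [Real.rpow_def_of_pos hεq, ← Real.exp_add, ← Real.le_log_iff_exp_le hF]
  refine le_trans ?_ h
  -- Optimality of `δ`: the tangent bound for `log` leaves minus a square in `h3`.
  have hlog : Real.log (1 - ε ^ 2) - Real.log (1 - δ ^ 2) ≤ (1 - ε ^ 2) / (1 - δ ^ 2) - 1 := by
    rw [← Real.log_div hεq.ne' hqpos.ne']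
    exact Real.log_le_sub_one_of_pos (by positivity)
  have h2 := mul_le_mul_of_nonneg_left hlog ha.le
  have h3 : a * ((1 - ε ^ 2) / (1 - δ ^ 2) - 1) + (ε - δ) * r =
      -(a * (δ - ε) ^ 2 / (1 - δ ^ 2)) := by
    rw [← hrδ]; field_simp; ring
  have h4 : 0 ≤ a * (δ - ε) ^ 2 / (1 - δ ^ 2) := by positivity
  linarith

/-! ### Moments of linear forms on the sphere, via Gaussian integrals -/

section SphereMoments

variable {E : Type*} [NormedAddCommGroup E] [InnerProductSpace ℝ E] [FiniteDimensional ℝ E]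
  [MeasurableSpace E] [BorelSpace E]

theorem integrable_inner_pow_mul_exp_neg_sq [Nontrivial E] (w : E) (k : ℕ) :
    Integrable (fun x : E => inner ℝ w x ^ k * Real.exp (-‖x‖ ^ 2)) := by
  have h : Integrable (fun x : E => (fun r : ℝ => ‖w‖ ^ k * (r ^ k * Real.exp (-r ^ 2))) ‖x‖) := by
    rw [integrable_fun_norm_addHaar (volume : Measure E)
      (f := fun r : ℝ => ‖w‖ ^ k * (r ^ k * Real.exp (-r ^ 2)))]
    have h1 := integrableOn_rpow_mul_exp_neg_rpow (p := 2)
      (s := ((Module.finrank ℝ E - 1 + k : ℕ) : ℝ))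
      (by linarith [(Module.finrank ℝ E - 1 + k : ℕ).cast_nonneg (α := ℝ)]) two_pos
    refine IntegrableOn.congr_fun (h1.const_mul (‖w‖ ^ k)) (fun r _ => ?_) measurableSet_Ioi
    simp only [Real.rpow_natCast, Real.rpow_two, smul_eq_mul, pow_add]
    ring
  refine h.mono' (by fun_prop) (.of_forall fun x => ?_)
  rw [norm_mul, Real.norm_of_nonneg (Real.exp_nonneg _), norm_pow]
  simp only
  rw [← mul_assoc, ← mul_pow]
  gcongr
  exact norm_inner_le_norm w x

/-- Integration by parts in the direction `w`. At `k = 0` the truncated exponent `k - 1` is harmless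
because of the factor `k`. -/
theorem two_mul_integral_inner_pow_mul_exp_neg_sq [Nontrivial E] (w : E) (k : ℕ) :
    2 * ∫ x : E, inner ℝ w x ^ (k + 1) * Real.exp (-‖x‖ ^ 2) =
      k * ‖w‖ ^ 2 * ∫ x : E, inner ℝ w x ^ (k - 1) * Real.exp (-‖x‖ ^ 2) := by
  have hf : ∀ x : E, HasFDerivAt (fun x : E => inner ℝ w x ^ k)
      ((k * inner ℝ w x ^ (k - 1)) • innerSL ℝ w) x := fun x => by
    simpa using ((innerSL ℝ w).hasFDerivAt (x := x)).pow k
  have hg : ∀ x : E, HasFDerivAt (fun x : E => Real.exp (-‖x‖ ^ 2))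
      (Real.exp (-‖x‖ ^ 2) • (-(2 • innerSL ℝ x) : E →L[ℝ] ℝ)) x := fun x =>
    ((hasStrictFDerivAt_norm_sq x).hasFDerivAt.neg).exp
  have ef : ∀ x : E, fderiv ℝ (fun x : E => inner ℝ w x ^ k) x w * Real.exp (-‖x‖ ^ 2) =
      k * ‖w‖ ^ 2 * (inner ℝ w x ^ (k - 1) * Real.exp (-‖x‖ ^ 2)) := fun x => by
    rw [(hf x).fderiv]
    simp
    ring
  have eg : ∀ x : E, inner ℝ w x ^ k * fderiv ℝ (fun x : E => Real.exp (-‖x‖ ^ 2)) x w =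
      -2 * (inner ℝ w x ^ (k + 1) * Real.exp (-‖x‖ ^ 2)) := fun x => by
    rw [(hg x).fderiv]
    simp [real_inner_comm w x]
    ring
  have h := integral_mul_fderiv_eq_neg_fderiv_mul_of_integrable (μ := (volume : Measure E))
    (f := fun x : E => inner ℝ w x ^ k) (g := fun x : E => Real.exp (-‖x‖ ^ 2)) (v := w)
    (by simpa only [ef] using (integrable_inner_pow_mul_exp_neg_sq w (k - 1)).const_mul _)
    (by simpa only [eg] using (integrable_inner_pow_mul_exp_neg_sq w (k + 1)).const_mul _)
    (integrable_inner_pow_mul_exp_neg_sq w k)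
    (fun x _ => (hf x).differentiableAt) (fun x _ => (hg x).differentiableAt)
  simp only [ef, eg, integral_const_mul] at h
  linarith

theorem integral_inner_pow_mul_exp_neg_sq_eq_toSphere [Nontrivial E] (w : E) (k : ℕ) :
    ∫ x : E, inner ℝ w x ^ k * Real.exp (-‖x‖ ^ 2) =
      (∫ u, inner ℝ w u.1 ^ k ∂(volume : Measure E).toSphere) *
        (1 / 2 * Real.Gamma (((Module.finrank ℝ E : ℝ) + k) / 2)) := by
  have hdim : 1 ≤ Module.finrank ℝ E := Module.finrank_pos
  calc
    _ = ∫ x : ({(0)}ᶜ : Set E), inner ℝ w x.1 ^ k * Real.exp (-‖x.1‖ ^ 2)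
        ∂((volume : Measure E).comap (↑)) := by
      rw [integral_subtype_comap (measurableSet_singleton _).compl
        fun x : E ↦ inner ℝ w x ^ k * Real.exp (-‖x‖ ^ 2), restrict_compl_singleton]
    _ = ∫ p, inner ℝ w p.1.1 ^ k * (p.2.1 ^ k * Real.exp (-p.2.1 ^ 2))
        ∂((volume : Measure E).toSphere.prod (.volumeIoiPow (Module.finrank ℝ E - 1))) := by
      rw [← (volume : Measure E).measurePreserving_homeomorphUnitSphereProd.integral_comp
        (Homeomorph.measurableEmbedding _)]
      refine integral_congr_ae (.of_forall fun x => ?_)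
      have hx : ‖x.1‖ ≠ 0 := norm_ne_zero_iff.2 x.2
      simp only [homeomorphUnitSphereProd_apply_fst_coe, homeomorphUnitSphereProd_apply_snd_coe,
        inner_smul_right]
      rw [← mul_assoc, ← mul_pow]
      field_simp
    _ = (∫ u, inner ℝ w u.1 ^ k ∂(volume : Measure E).toSphere) *
        ∫ r : Set.Ioi (0 : ℝ), r.1 ^ k * Real.exp (-r.1 ^ 2)
          ∂.volumeIoiPow (Module.finrank ℝ E - 1) :=
      integral_prod_mul (fun u : Metric.sphere (0 : E) 1 => inner ℝ w u.1 ^ k)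
        fun r : Set.Ioi (0 : ℝ) => r.1 ^ k * Real.exp (-r.1 ^ 2)
    _ = _ := by
      congr 1
      simp only [Measure.volumeIoiPow, ENNReal.ofReal]
      rw [integral_withDensity_eq_integral_smul
          (measurable_subtype_coe.pow_const _).real_toNNReal,
        integral_subtype_comap measurableSet_Ioi fun r : ℝ ↦
          Real.toNNReal (r ^ (Module.finrank ℝ E - 1)) • (r ^ k * Real.exp (-r ^ 2))]
      have h := integral_rpow_mul_exp_neg_rpow (p := 2)
        (q := ((Module.finrank ℝ E - 1 + k : ℕ) : ℝ)) two_pos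
        (by linarith [(Module.finrank ℝ E - 1 + k : ℕ).cast_nonneg (α := ℝ)])
      have e : (((Module.finrank ℝ E - 1 + k : ℕ) : ℝ) + 1) / 2 =
          ((Module.finrank ℝ E : ℝ) + k) / 2 := by
        push_cast [Nat.cast_sub hdim]; ring
      rw [← e, ← h]
      refine setIntegral_congr_fun measurableSet_Ioi fun r hr ↦ ?_
      simp only [NNReal.smul_def, Real.coe_toNNReal _ (pow_nonneg (le_of_lt hr) _),
        Real.rpow_natCast, Real.rpow_two, smul_eq_mul, pow_add]
      ring

/-- Polar coordinates turn the Gaussian recursion into one on the sphere; the radial Gamma factors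
cancel through `Γ(x+1) = xΓ(x)`. -/
theorem integral_toSphere_inner_pow_succ [Nontrivial E] (w : E) (k : ℕ) :
    ((Module.finrank ℝ E : ℝ) + k - 1) *
        ∫ u, inner ℝ w u.1 ^ (k + 1) ∂(volume : Measure E).toSphere =
      k * ‖w‖ ^ 2 * ∫ u, inner ℝ w u.1 ^ (k - 1) ∂(volume : Measure E).toSphere := by
  have hdim : (1 : ℝ) ≤ Module.finrank ℝ E := by exact_mod_cast Module.finrank_pos (R := ℝ) (M := E)
  have h := two_mul_integral_inner_pow_mul_exp_neg_sq w k
  simp only [integral_inner_pow_mul_exp_neg_sq_eq_toSphere] at h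
  cases k with
  | zero =>
    have hG : 0 < Real.Gamma (((Module.finrank ℝ E : ℝ) + 1) / 2) :=
      Real.Gamma_pos_of_pos (by positivity)
    have : ∫ u, inner ℝ w u.1 ^ 1 ∂(volume : Measure E).toSphere = 0 := by
      simpa [hG.ne'] using h
    simp only [zero_add, this]
    simp
  | succ j =>
    have e : ((Module.finrank ℝ E : ℝ) + ((j + 1 + 1 : ℕ) : ℝ)) / 2 =
        ((Module.finrank ℝ E : ℝ) + j) / 2 + 1 := by push_cast; ring
    have hpos : 0 < ((Module.finrank ℝ E : ℝ) + j) / 2 := by positivity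
    have hG := Real.Gamma_pos_of_pos hpos
    simp only [Nat.add_sub_cancel] at h ⊢
    rw [e, Real.Gamma_add_one hpos.ne'] at h
    have h' := mul_right_cancel₀ (b := Real.Gamma (((Module.finrank ℝ E : ℝ) + j) / 2) / 2)
      (by positivity) (show
        (((Module.finrank ℝ E : ℝ) + j) *
          ∫ u, inner ℝ w u.1 ^ (j + 1 + 1) ∂(volume : Measure E).toSphere) * _ =
        (((j + 1 : ℕ) : ℝ) * ‖w‖ ^ 2 *
          ∫ u, inner ℝ w u.1 ^ j ∂(volume : Measure E).toSphere) * _ by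
        linear_combination h)
    rw [← h']
    push_cast
    ring

end SphereMoments

/-! ### Laplace transform of the uniform law -/

theorem integral_uniformSphere {n : ℕ}
    (f : Metric.sphere (0 : EuclideanSpace ℝ (Fin n)) 1 → ℝ) :
    ∫ u, f u ∂uniformSphere n =
      (((volume : Measure (EuclideanSpace ℝ (Fin n))).toSphere Set.univ)⁻¹).toReal *
        ∫ u, f u ∂(volume : Measure (EuclideanSpace ℝ (Fin n))).toSphere := by
  rw [uniformSphere, integral_smul_measure, smul_eq_mul]

theorem integral_uniformSphere_inner_pow_odd {n : ℕ} (hn : 1 ≤ n)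
    (w : EuclideanSpace ℝ (Fin n)) (k : ℕ) :
    ∫ u, inner ℝ w u.1 ^ (2 * k + 1) ∂uniformSphere n = 0 := by
  have : Nonempty (Fin n) := ⟨⟨0, hn⟩⟩
  have hn' : (1 : ℝ) ≤ n := by exact_mod_cast hn
  rw [integral_uniformSphere]
  suffices h : ∫ u, inner ℝ w u.1 ^ (2 * k + 1)
      ∂(volume : Measure (EuclideanSpace ℝ (Fin n))).toSphere = 0 by rw [h, mul_zero]
  induction k with
  | zero =>
    -- The sphere recursion is void at `k = 0` when `n = 1`, its left factor being `0`; the Gaussian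
    -- identity still applies.
    have h := two_mul_integral_inner_pow_mul_exp_neg_sq w 0
    rw [integral_inner_pow_mul_exp_neg_sq_eq_toSphere] at h
    have hG : 0 < Real.Gamma (((n : ℝ) + 1) / 2) := Real.Gamma_pos_of_pos (by positivity)
    simpa [hG.ne'] using h
  | succ j ih =>
    have h := integral_toSphere_inner_pow_succ w (2 * j + 2)
    rw [show 2 * j + 2 - 1 = 2 * j + 1 from rfl, ih, mul_zero] at h
    refine (mul_eq_zero.1 h).resolve_left ?_
    rw [finrank_euclideanSpace_fin]
    push_cast
    have : (0 : ℝ) < n + (2 * j + 2) - 1 := by linarith [j.cast_nonneg (α := ℝ)]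
    exact this.ne'

/-- Divided by `(2k)!`, the even moments obey the recursion `besselCoeff_succ` with `a = n/2`. -/
theorem integral_uniformSphere_inner_pow_even {n : ℕ} (hn : 1 ≤ n)
    (w : EuclideanSpace ℝ (Fin n)) (k : ℕ) :
    (∫ u, inner ℝ w u.1 ^ (2 * k) ∂uniformSphere n) / (2 * k).factorial =
      besselCoeff ((n : ℝ) / 2) k * (‖w‖ ^ 2 / 4) ^ k := by
  have : Nonempty (Fin n) := ⟨⟨0, hn⟩⟩
  have := uniformSphere_isProbabilityMeasure hn
  have hn' : (1 : ℝ) ≤ n := by exact_mod_cast hn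
  induction k with
  | zero => simp [besselCoeff_zero]
  | succ j ih =>
    have h := integral_toSphere_inner_pow_succ w (2 * j + 1)
    rw [show 2 * j + 1 - 1 = 2 * j from rfl, finrank_euclideanSpace_fin] at h
    have h' : ((n : ℝ) + ((2 * j + 1 : ℕ) : ℝ) - 1) *
        ∫ u, inner ℝ w u.1 ^ (2 * j + 1 + 1) ∂uniformSphere n =
        ((2 * j + 1 : ℕ) : ℝ) * ‖w‖ ^ 2 * ∫ u, inner ℝ w u.1 ^ (2 * j) ∂uniformSphere n := by
      rw [integral_uniformSphere, integral_uniformSphere]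
      linear_combination ((((volume : Measure (EuclideanSpace ℝ (Fin n))).toSphere
        Set.univ)⁻¹).toReal) * h
    have hc := besselCoeff_succ (a := (n : ℝ) / 2) (by positivity) j
    rw [← hc] at ih
    rw [show 2 * (j + 1) = 2 * j + 1 + 1 by ring, Nat.factorial_succ, Nat.factorial_succ]
    rw [div_eq_iff (by positivity)] at ih ⊢
    push_cast at ih h' ⊢
    refine mul_left_cancel₀ (show (n : ℝ) + 2 * j ≠ 0 by positivity) ?_
    rw [ih] at h'
    linear_combination h'

/-- The Laplace transform of the uniform distribution on the unit sphere. -/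
theorem integral_exp_inner_uniformSphere {n : ℕ} (hn : 1 ≤ n) (w : EuclideanSpace ℝ (Fin n)) :
    ∫ u, Real.exp (inner ℝ w u.1) ∂uniformSphere n =
      besselSeries ((n : ℝ) / 2) (‖w‖ ^ 2 / 4) := by
  have := uniformSphere_isProbabilityMeasure hn
  have hn' : (0 : ℝ) < (n : ℝ) / 2 := by positivity
  have hs : HasSum (fun k : ℕ => ∫ u, inner ℝ w u.1 ^ k / k.factorial ∂uniformSphere n)
      (∫ u, Real.exp (inner ℝ w u.1) ∂uniformSphere n) := by
    refine hasSum_integral_of_dominated_convergence (fun k _ => ‖w‖ ^ k / k.factorial)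
      (fun k => (by fun_prop : Continuous _).aestronglyMeasurable) (fun k => .of_forall fun u => ?_)
      (.of_forall fun _ => Real.summable_pow_div_factorial _) (integrable_const _)
      (.of_forall fun u => ?_)
    · rw [norm_div, norm_pow, Real.norm_natCast]
      gcongr
      refine (norm_inner_le_norm w u.1).trans_eq ?_
      rw [norm_eq_of_mem_sphere u, mul_one]
    · rw [Real.exp_eq_exp_ℝ]
      exact NormedSpace.expSeries_div_hasSum_exp _
  simp only [integral_div] at hs
  have he : HasSum (fun k : ℕ => (∫ u, inner ℝ w u.1 ^ (2 * k) ∂uniformSphere n) /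
      (2 * k).factorial) (besselSeries ((n : ℝ) / 2) (‖w‖ ^ 2 / 4)) := by
    simp only [integral_uniformSphere_inner_pow_even hn]
    exact (summable_besselSeries hn' _).hasSum
  have ho : HasSum (fun k : ℕ => (∫ u, inner ℝ w u.1 ^ (2 * k + 1) ∂uniformSphere n) /
      (2 * k + 1).factorial) 0 := by
    simp only [integral_uniformSphere_inner_pow_odd hn, zero_div]
    exact hasSum_zero
  have heo := HasSum.even_add_odd (f := fun k : ℕ =>
    (∫ u, inner ℝ w u.1 ^ k ∂uniformSphere n) / k.factorial) he ho
  rw [add_zero] at heo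
  exact hs.unique heo

theorem rpow_mul_exp_le_integral_exp_inner {n : ℕ} (hn : 1 ≤ n) (w : EuclideanSpace ℝ (Fin n))
    {ε : ℝ} (hε0 : 0 < ε) (hε1 : ε < 1) :
    (1 - ε ^ 2) ^ ((n : ℝ) / 2) * Real.exp (ε * ‖w‖) ≤
      ∫ u, Real.exp (inner ℝ w u.1) ∂uniformSphere n := by
  rw [integral_exp_inner_uniformSphere hn]
  exact rpow_mul_exp_le_besselSeries (by positivity) hε0 hε1 (norm_nonneg w)

/-! ### The matrix energy -/

theorem rpow_mul_exp_norm_le_matrixEnergy {m n : ℕ} (hm : 1 ≤ m) (hn : 1 ≤ n)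
    (B : Matrix (Fin m) (Fin n) ℝ) {ε : ℝ} (hε0 : 0 < ε) (hε1 : ε < 1)
    {v₀ : EuclideanSpace ℝ (Fin n)} (hv₀ : ‖v₀‖ = 1) :
    (1 - ε ^ 2) ^ (((m : ℝ) + (n : ℝ)) / 2) *
      Real.exp (ε ^ 2 * ‖Matrix.toEuclideanLin B v₀‖) ≤ matrixEnergy B := by
  have := uniformSphere_isProbabilityMeasure hm
  have := uniformSphere_isProbabilityMeasure hn
  have hq : 0 < 1 - ε ^ 2 := by nlinarith
  set T := Matrix.toEuclideanLin B with hT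
  have hTc : Continuous T := T.continuous_of_finiteDimensional
  have hin : ∀ (u : EuclideanSpace ℝ (Fin m)) (v : EuclideanSpace ℝ (Fin n)),
      u.ofLp ⬝ᵥ (B *ᵥ v.ofLp) = inner ℝ (T.adjoint u) v := fun u v => by
    rw [LinearMap.adjoint_inner_left, EuclideanSpace.inner_eq_star_dotProduct, dotProduct_comm]
    simp [hT]
  have hac : Continuous T.adjoint := T.adjoint.continuous_of_finiteDimensional
  have hcont : Continuous fun p : Metric.sphere (0 : EuclideanSpace ℝ (Fin m)) 1 ×
      Metric.sphere (0 : EuclideanSpace ℝ (Fin n)) 1 =>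
      Real.exp (inner ℝ (T.adjoint p.1.1) p.2.1) := by fun_prop
  have hint : Integrable (fun p : Metric.sphere (0 : EuclideanSpace ℝ (Fin m)) 1 ×
      Metric.sphere (0 : EuclideanSpace ℝ (Fin n)) 1 =>
      Real.exp (inner ℝ (T.adjoint p.1.1) p.2.1)) ((uniformSphere m).prod (uniformSphere n)) :=
    hcont.integrable_of_hasCompactSupport (HasCompactSupport.of_compactSpace _)
  have hcont' : Continuous fun u : Metric.sphere (0 : EuclideanSpace ℝ (Fin m)) 1 =>
      (1 - ε ^ 2) ^ ((n : ℝ) / 2) * Real.exp (inner ℝ (ε • T v₀) u.1) := by fun_prop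
  unfold matrixEnergy
  simp only [hin]
  rw [integral_prod _ hint]
  calc
    _ = (1 - ε ^ 2) ^ ((n : ℝ) / 2) *
        ((1 - ε ^ 2) ^ ((m : ℝ) / 2) * Real.exp (ε * ‖ε • T v₀‖)) := by
      rw [add_div, Real.rpow_add hq, norm_smul, Real.norm_of_nonneg hε0.le]
      ring_nf
    _ ≤ (1 - ε ^ 2) ^ ((n : ℝ) / 2) *
        ∫ u, Real.exp (inner ℝ (ε • T v₀) u.1) ∂uniformSphere m := by
      gcongr
      exact rpow_mul_exp_le_integral_exp_inner hm _ hε0 hε1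
    _ = ∫ u, (1 - ε ^ 2) ^ ((n : ℝ) / 2) * Real.exp (inner ℝ (ε • T v₀) u.1)
        ∂uniformSphere m := (integral_const_mul _ _).symm
    _ ≤ _ := by
      refine integral_mono (hcont'.integrable_of_hasCompactSupport
        (HasCompactSupport.of_compactSpace _)) hint.integral_prod_left fun u => ?_
      refine le_trans ?_ (rpow_mul_exp_le_integral_exp_inner hn (T.adjoint u.1) hε0 hε1)
      simp only
      gcongr
      -- Cauchy–Schwarz with `‖v₀‖ = 1` makes the exponent linear in `u`, so the sphere bound
      -- applies again.
      rw [inner_smul_left, real_inner_comm, ← LinearMap.adjoint_inner_left]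
      simp only [conj_trivial]
      gcongr
      simpa [hv₀] using real_inner_le_norm (T.adjoint u.1) v₀

theorem mainTheorem5 (m n : ℕ) (hm : 1 ≤ m) (hn : 1 ≤ n) (A : Matrix (Fin m) (Fin n) ℝ)
    (l ε : ℝ) (hε0 : 0 < ε) (hε1 : ε < 1) :
    (1 - ε ^ 2) ^ (((m : ℝ) + (n : ℝ)) / 2) * Real.exp (ε ^ 2 * matrixOpNorm (l • A)) ≤
      matrixEnergy (l • A) := by
  have hq : 0 < 1 - ε ^ 2 := by nlinarith
  have hC : 0 < (1 - ε ^ 2) ^ (((m : ℝ) + (n : ℝ)) / 2) := Real.rpow_pos_of_pos hq _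
  have h := fun v₀ hv₀ =>
    rpow_mul_exp_norm_le_matrixEnergy hm hn (l • A) hε0 hε1 (v₀ := v₀) hv₀
  set Φ := matrixEnergy (l • A)
  set C := (1 - ε ^ 2) ^ (((m : ℝ) + (n : ℝ)) / 2)
  have hΦ : 0 < Φ := (by positivity : (0 : ℝ) < _).trans_le
    (h (EuclideanSpace.single ⟨0, hn⟩ 1) (by simp))
  -- Solving for the norm gives a bound independent of `v₀`, hence one for the operator norm.
  have h' : ∀ v₀, ‖v₀‖ = 1 →
      ‖Matrix.toEuclideanLin (l • A) v₀‖ ≤ Real.log (Φ / C) / ε ^ 2 := fun v₀ hv₀ => by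
    rw [le_div_iff₀ (by positivity), Real.le_log_iff_exp_le (by positivity),
      le_div_iff₀ hC, mul_comm, mul_comm _ (ε ^ 2)]
    exact h v₀ hv₀
  have hnorm : matrixOpNorm (l • A) ≤ Real.log (Φ / C) / ε ^ 2 :=
    ContinuousLinearMap.opNorm_le_of_unit_norm
      ((norm_nonneg _).trans (h' (EuclideanSpace.single ⟨0, hn⟩ 1) (by simp)))
      fun v hv => h' v hv
  rw [le_div_iff₀ (by positivity), Real.le_log_iff_exp_le (by positivity),
      le_div_iff₀ hC, mul_comm, mul_comm _ (ε ^ 2)] at hnorm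
  exact hnorm
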